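/- For $n\in\mathbb N_0$ let $M_n(z;\beta,c)=\dfrac{c^n(\beta)_n}{(c-1)^n}\,{}_2F_1\!\left(-n,-z;\beta;1-\tfrac1c\right)$ be the monic Meixner polynomial, where $(\beta)_n=\beta(\beta+1)\cdots(\beta+n-1)$. Let $\beta,c\in\mathbb C$ with $c\notin[0,\infty)$ and $-\beta\notin\{0,1,2,\dots\}$. Let $C$ be a contour in $\mathbb C$ from $-i\infty$ to $i\infty$ that separates $\{0,1,2,\dots\}$ from $\{-\beta,-\beta-1,-\beta-2,\dots\}$. Then, for all integers $0\le m<n$, $$\int_C M_n(z;\beta,c)\,z^m\,\Gamma(-z)\,\Gamma(\beta+z)\,(-c)^z\,dz=0 ,$$ where $(-c)^z=e^{z\operatorname{Log}(-c)}$ with the principal logarithm. Here a contour from $-i\infty$ to $i\infty$ is a continuous curve $\gamma:\mathbb R\to\mathbb C$, piecewise $C^1$ or, more generally, differentiable off a countable set with locally integrable derivative, such that $\operatorname{Im}\gamma(t)\to\pm\infty$ and $\operatorname{Re}\gamma(t)/\operatorname{Im}\gamma(t)\to0$ as $t\to\pm\infty$. It separates two sets if they lie in two different connected components of the complement of the curve.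 The integral is the improper integral $\lim_{a\to-\infty,\;b\to\infty}\int_a^b f(\gamma(t))\gamma'(t)\,dt$, with independent limits; its convergence is part of the claim. -/

import Mathlib

open Filter Topology MeasureTheory

noncomputable section

/-- The monic Meixner polynomial `M_n(z; β, c)`, in its hypergeometric representation
`c^n (β)_n / (c-1)^n · ₂F₁(-n, -z; β; 1 - 1/c)`. The series terminates. -/
def meixner (n : ℕ) (β c z : ℂ) : ℂ :=
  c ^ n * (ascPochhammer ℂ n).eval β / (c - 1) ^ n *
    ordinaryHypergeometric (-(n : ℂ)) (-z) β (1 - 1 / c)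

/-- The weight `Γ(-z) Γ(β+z) (-c)^z`. The power is the principal one, which is the analytic
continuation, to `c ∈ ℂ ∖ [0,∞)`, of the usual positive-base power for `c < 0`. -/
def meixnerWeight (β c z : ℂ) : ℂ :=
  Complex.Gamma (-z) * Complex.Gamma (β + z) * (-c) ^ z

/-- `γ` parametrizes a contour from `-i∞` to `i∞`. It is a continuous curve, differentiable off a
countable set with a locally integrable derivative (every piecewise `C¹` curve is such), and
it escapes to infinity in the directions `-i` and `i`. Bounded real part is allowed,
but not required, and the curve may cross itself. -/
structure IsVerticalContour (γ : ℝ → ℂ) : Prop where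
  continuous : Continuous γ
  differentiable : ∃ S : Set ℝ, S.Countable ∧ ∀ t ∉ S, DifferentiableAt ℝ γ t
  integrable_deriv : ∀ a b : ℝ, IntervalIntegrable (deriv γ) volume a b
  im_atBot : Tendsto (fun t => (γ t).im) atBot atBot
  im_atTop : Tendsto (fun t => (γ t).im) atTop atTop
  direction_atBot : Tendsto (fun t => (γ t).re / (γ t).im) atBot (𝓝 0)
  direction_atTop : Tendsto (fun t => (γ t).re / (γ t).im) atTop (𝓝 0)

/-- The closed set `C` separates `A` from `B`: these lie in two different connected components of
the complement of `C` (in particular neither meets `C`). -/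
def Separates (C A B : Set ℂ) : Prop :=
  ∃ p q : ℂ, A ⊆ connectedComponentIn Cᶜ p ∧ B ⊆ connectedComponentIn Cᶜ q ∧
    Disjoint (connectedComponentIn Cᶜ p) (connectedComponentIn Cᶜ q)

/-- The improper contour integral of `f` along `γ`, taken with independent limits at the two ends,
converges and has the value `I`. -/
def HasContourIntegral (f : ℂ → ℂ) (γ : ℝ → ℂ) (I : ℂ) : Prop :=
  (∀ a b : ℝ, IntervalIntegrable (fun t => f (γ t) * deriv γ t) volume a b) ∧
    Tendsto (fun p : ℝ × ℝ => ∫ t in p.1..p.2, f (γ t) * deriv γ t)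
      (atBot ×ˢ atTop) (𝓝 I)

end

/-! Let w be the weight and G(z) = P(z) Γ(1-z) Γ(β+z) (-c)^z with P a polynomial. The functional
equation of Γ gives G(z+1) - G(z) = (z P(z) - c(β+z) P(z+1)) w(z). It suffices that M_n(z) z^m has
this form (`meixner_mul_pow_mem`) and that such differences integrate to 0.

Algebra: modulo these exact functions, (-z)_k (β+z)_j is a constant
(`pochhammerPair_sub_const_mem`). Inserted into the hypergeometric sum for M_n(z) (β+z)_j, the
constants assemble to an n-th finite difference of a polynomial of degree j < n.

Analysis: where no singularity is swept, g(z+1) - g(z) has a primitive that tends to 0 at both ends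
(`HasContourIntegral.translate_sub`). The unit shift may sweep over poles of G, but for every pole p
the points p and p - 1 lie in one component of the complement of the curve, so the residue terms
cancel. Winding numbers are avoided: partial fractions isolate the poles near the contour, and a
model pole is moved inside its component by small steps (`HasContourIntegral.gaussianPole_sub`).
Decay of G comes from the reflection formula and the Beta integral
(`Gamma_mul_Gamma_isBigO_exp_im`). -/

/-! ### Algebra: reduction modulo exact functions. -/

/-- The polynomial multiples of the Meixner weight that are differences of polynomial multiples
of `Γ(1-z) Γ(β+z) (-c)^z`, with the weight divided out. -/
def meixnerExact (β c : ℂ) : Submodule ℂ (ℂ → ℂ) where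
  carrier := {F | ∃ P : Polynomial ℂ, ∀ z, F z = z * P.eval z - c * (β + z) * P.eval (z + 1)}
  add_mem' := by
    rintro F G ⟨P, hP⟩ ⟨Q, hQ⟩
    refine ⟨P + Q, fun z => ?_⟩
    simp only [Pi.add_apply, hP, hQ, Polynomial.eval_add]
    ring
  zero_mem' := ⟨0, by simp⟩
  smul_mem' := by
    rintro a F ⟨P, hP⟩
    refine ⟨Polynomial.C a * P, fun z => ?_⟩
    simp only [Pi.smul_apply, hP, Polynomial.eval_mul, Polynomial.eval_C, smul_eq_mul]
    ring

lemma ascPochhammer_succ_eval_left (n : ℕ) (z : ℂ) :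
    (ascPochhammer ℂ (n + 1)).eval z = z * (ascPochhammer ℂ n).eval (z + 1) := by
  simp [ascPochhammer_succ_left]

/-- The basis function `(-z)_k (β+z)_j`. -/
noncomputable def pochhammerPair (β : ℂ) (k j : ℕ) (z : ℂ) : ℂ :=
  (ascPochhammer ℂ k).eval (-z) * (ascPochhammer ℂ j).eval (β + z)

lemma pochhammerPair_succ_add_mem (β c : ℂ) (k j : ℕ) :
    pochhammerPair β (k + 1) j + c • pochhammerPair β k (j + 1) ∈ meixnerExact β c := by
  -- P(z) = -(1-z)_k (β+z)_j: the prefactors z and β + z supply the missing first factors of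
  -- (-z)_{k+1} and (β+z)_{j+1}.
  refine ⟨-((ascPochhammer ℂ k).comp (1 - Polynomial.X) *
    (ascPochhammer ℂ j).comp (Polynomial.C β + Polynomial.X)), fun z => ?_⟩
  have h1 : (1 : ℂ) - (z + 1) = -z := by ring
  have h2 : -z + 1 = 1 - z := by ring
  simp only [pochhammerPair, Pi.add_apply, Pi.smul_apply, smul_eq_mul,
    ascPochhammer_succ_eval_left, Polynomial.eval_neg, Polynomial.eval_mul,
    Polynomial.eval_comp, Polynomial.eval_sub, Polynomial.eval_one, Polynomial.eval_X,
    Polynomial.eval_add, Polynomial.eval_C, h1, h2, ← add_assoc]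
  ring

lemma pochhammerPair_add (β : ℂ) (k j : ℕ) :
    pochhammerPair β k (j + 1) + pochhammerPair β (k + 1) j =
      (β + j + k) • pochhammerPair β k j := by
  ext z
  simp only [pochhammerPair, Pi.add_apply, Pi.smul_apply, smul_eq_mul, ascPochhammer_succ_eval]
  ring

lemma pochhammerPair_sub_const_mem {β c : ℂ} (hc : c ≠ 1) (k j : ℕ) :
    pochhammerPair β k j - (fun _ => (-c) ^ k * (ascPochhammer ℂ (k + j)).eval β /
      (1 - c) ^ (k + j)) ∈ meixnerExact β c := by
  have hc' : 1 - c ≠ 0 := sub_ne_zero.2 hc.symm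
  induction k generalizing j with
  | zero =>
    induction j with
    | zero =>
      convert (meixnerExact β c).zero_mem using 1
      ext z
      simp [pochhammerPair]
    | succ j ih =>
      -- Eliminating (-z)(β+z)_j between the exact relation and the contiguous one leaves
      -- (1-c)(β+z)_{j+1} ≡ (β+j)(β+z)_j.
      have h := (meixnerExact β c).smul_mem (1 - c)⁻¹ ((meixnerExact β c).sub_mem
        ((meixnerExact β c).smul_mem (β + j) ih) (pochhammerPair_succ_add_mem β c 0 j))
      convert h using 1
      have h2 := pochhammerPair_add β 0 j
      ext z
      have h3 := congrFun h2 z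
      simp only [Pi.add_apply, Pi.sub_apply, Pi.smul_apply, smul_eq_mul, zero_add, pow_zero,
        ← add_assoc, ascPochhammer_succ_eval, Nat.cast_zero, add_zero] at h3 ⊢
      rw [eq_sub_of_add_eq' h3]
      field_simp
      ring
  | succ k ih =>
    have h := (meixnerExact β c).sub_mem (pochhammerPair_succ_add_mem β c k j)
      ((meixnerExact β c).smul_mem c (ih (j + 1)))
    convert h using 1
    ext z
    have e : k + 1 + j = k + (j + 1) := by ring
    simp only [Pi.add_apply, Pi.sub_apply, Pi.smul_apply, smul_eq_mul, e]
    ring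

lemma ordinaryHypergeometric_neg_nat_eq_sum (n : ℕ) (b c x : ℂ) :
    ordinaryHypergeometric (-(n : ℂ)) b c x = ∑ k ∈ Finset.range (n + 1),
      (-1) ^ k * (n.choose k : ℂ) * (ascPochhammer ℂ k).eval b /
        (ascPochhammer ℂ k).eval c * x ^ k := by
  rw [ordinaryHypergeometric_eq_tsum]
  simp only [smul_eq_mul]
  rw [tsum_eq_sum (s := Finset.range (n + 1))]
  · refine Finset.sum_congr rfl fun k _ => ?_
    rw [ascPochhammer_eval_neg_eq_descPochhammer, descPochhammer_eval_eq_descFactorial,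
      Nat.descFactorial_eq_factorial_mul_choose]
    have : (k.factorial : ℂ) ≠ 0 := by exact_mod_cast k.factorial_ne_zero
    push_cast
    field_simp
  · intro k hk
    rw [Finset.mem_range, not_lt] at hk
    rw [ascPochhammer_eval_neg_coe_nat_of_lt (by lia)]
    simp

lemma sum_neg_one_pow_mul_choose_mul_eval_eq_zero (P : Polynomial ℂ) {n : ℕ}
    (h : P.natDegree < n) (y : ℂ) :
    ∑ k ∈ Finset.range (n + 1), (-1) ^ k * (n.choose k : ℂ) * P.eval (y + k) = 0 := by
  have h1 := congrFun (Polynomial.fwdDiff_iter_eq_zero_of_degree_lt h) y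
  rw [fwdDiff_iter_eq_sum_shift] at h1
  have h2 : (-1 : ℂ) ^ n * 0 = 0 := by simp
  rw [← h2, ← (show (0 : ℂ → ℂ) y = 0 from rfl), ← h1, Finset.mul_sum]
  refine Finset.sum_congr rfl fun k hk => ?_
  have hk' : k ≤ n := by simpa [Nat.lt_succ_iff] using hk
  have h3 : (-1 : ℂ) ^ n * (-1) ^ (n - k) = (-1) ^ k := by
    rw [← pow_add, show n + (n - k) = k + 2 * (n - k) by lia, pow_add, pow_mul]
    simp
  simp only [zsmul_eq_mul, nsmul_eq_mul, mul_one]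
  push_cast
  rw [← h3]
  ring

lemma ascPochhammer_eval_ne_zero {β : ℂ} (hβ : ∀ k : ℕ, -β ≠ (k : ℂ)) (n : ℕ) :
    (ascPochhammer ℂ n).eval β ≠ 0 := by
  rw [Ne, ascPochhammer_eval_eq_zero_iff]
  rintro ⟨k, -, hk⟩
  exact hβ k hk.symm

lemma ascPochhammer_eval_add (β : ℂ) (k j : ℕ) :
    (ascPochhammer ℂ (k + j)).eval β =
      (ascPochhammer ℂ k).eval β * (ascPochhammer ℂ j).eval (β + k) := by
  rw [← ascPochhammer_mul]
  simp

lemma meixner_mul_ascPochhammer_mem {β c : ℂ} (h0 : c ≠ 0) (h1 : c ≠ 1)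
    (hβ : ∀ k : ℕ, -β ≠ (k : ℂ)) {n j : ℕ} (hj : j < n) :
    (fun z => meixner n β c z * (ascPochhammer ℂ j).eval (β + z)) ∈ meixnerExact β c := by
  have hc' : 1 - c ≠ 0 := sub_ne_zero.2 h1.symm
  let K := c ^ n * (ascPochhammer ℂ n).eval β / (c - 1) ^ n
  let u : ℕ → ℂ := fun k => (-1) ^ k * (n.choose k : ℂ) / (ascPochhammer ℂ k).eval β *
    (1 - 1 / c) ^ k
  have key : ∑ k ∈ Finset.range (n + 1), u k • (pochhammerPair β k j - (fun _ => (-c) ^ k *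
      (ascPochhammer ℂ (k + j)).eval β / (1 - c) ^ (k + j))) ∈ meixnerExact β c :=
    (meixnerExact β c).sum_mem fun k _ =>
      (meixnerExact β c).smul_mem _ (pochhammerPair_sub_const_mem h1 k j)
  convert (meixnerExact β c).smul_mem K key using 1
  ext z
  have hs := sum_neg_one_pow_mul_choose_mul_eval_eq_zero (ascPochhammer ℂ j)
    (by rwa [ascPochhammer_natDegree]) β
  have hs' : ∑ k ∈ Finset.range (n + 1), u k * ((-c) ^ k *
      (ascPochhammer ℂ (k + j)).eval β / (1 - c) ^ (k + j)) = 0 := by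
    -- The k-th powers cancel and (β)_{k+j} / (β)_k = (β+k)_j, a polynomial of degree j sampled at β
    -- + k.
    rw [← mul_zero ((1 - c) ^ j)⁻¹, ← hs, Finset.mul_sum]
    refine Finset.sum_congr rfl fun k _ => ?_
    have hk := ascPochhammer_eval_ne_zero hβ k
    have e : (1 - 1 / c) ^ k * (-c) ^ k = (1 - c) ^ k := by
      rw [← mul_pow]
      congr 1
      field_simp
      ring
    calc u k * ((-c) ^ k * (ascPochhammer ℂ (k + j)).eval β / (1 - c) ^ (k + j))
        = (-1) ^ k * (n.choose k : ℂ) / (ascPochhammer ℂ k).eval β * ((1 - 1 / c) ^ k * (-c) ^ k)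
          * (ascPochhammer ℂ (k + j)).eval β / (1 - c) ^ (k + j) := by
          simp only [u]; ring
      _ = _ := by
          rw [e, ascPochhammer_eval_add, pow_add]
          field_simp
  simp only [Pi.smul_apply, Finset.sum_apply, Pi.sub_apply, smul_eq_mul, mul_sub,
    Finset.sum_sub_distrib, hs', sub_zero]
  rw [meixner, ordinaryHypergeometric_neg_nat_eq_sum, mul_assoc, Finset.sum_mul]
  congr 1
  refine Finset.sum_congr rfl fun k _ => ?_
  simp only [u, pochhammerPair]
  ring

lemma meixner_mul_pow_mem {β c : ℂ} (h0 : c ≠ 0) (h1 : c ≠ 1)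
    (hβ : ∀ k : ℕ, -β ≠ (k : ℂ)) {n m : ℕ} (hm : m < n) :
    (fun z => meixner n β c z * z ^ m) ∈ meixnerExact β c := by
  -- A factor z is traded for Pochhammer factors through z = (β+z+j) - (β+j), which raises j; hence
  -- the induction runs over all j.
  have key : ∀ m j : ℕ, m + j < n →
      (fun z => meixner n β c z * (ascPochhammer ℂ j).eval (β + z) * z ^ m) ∈
        meixnerExact β c := by
    intro m
    induction m with
    | zero =>
      intro j hj
      simpa using meixner_mul_ascPochhammer_mem h0 h1 hβ (by lia : j < n)
    | succ m ih =>
      intro j hj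
      convert (meixnerExact β c).sub_mem (ih (j + 1) (by lia))
        ((meixnerExact β c).smul_mem (β + j) (ih j (by lia))) using 1
      ext z
      simp only [Pi.sub_apply, Pi.smul_apply, smul_eq_mul, ascPochhammer_succ_eval]
      ring
  simpa using key m 0 (by lia)

/-! ### The filter of vertical approach to infinity. -/

/-- Approach to infinity in the vertical directions: `|Im z| → ∞` and `Re z / Im z → 0`. -/
noncomputable def verticalInfinity : Filter ℂ :=
  comap (fun z => |z.im|) atTop ⊓ comap (fun z => z.re / z.im) (𝓝 0)

lemma tendsto_verticalInfinity_iff {α : Type*} {l : Filter α} {u : α → ℂ} :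
    Tendsto u l verticalInfinity ↔ Tendsto (fun x => |(u x).im|) l atTop ∧
      ∀ ε : ℝ, 0 < ε → ∀ᶠ x in l, |(u x).re| ≤ ε * |(u x).im| := by
  rw [verticalInfinity, tendsto_inf, tendsto_comap_iff, tendsto_comap_iff]
  refine and_congr_right fun h => ?_
  simp only [Function.comp_def] at h ⊢
  rw [Metric.tendsto_nhds]
  constructor
  · intro H ε hε
    filter_upwards [H ε hε, h.eventually_gt_atTop 0] with x hx h0
    rw [dist_zero_right, Real.norm_eq_abs, abs_div, div_lt_iff₀ h0] at hx
    exact hx.le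
  · intro H ε hε
    filter_upwards [H (ε / 2) (half_pos hε), h.eventually_gt_atTop 0] with x hx h0
    rw [dist_zero_right, Real.norm_eq_abs, abs_div, div_lt_iff₀ h0]
    nlinarith

lemma tendsto_abs_im_verticalInfinity :
    Tendsto (fun z : ℂ => |z.im|) verticalInfinity atTop :=
  (tendsto_verticalInfinity_iff.1 tendsto_id).1

lemma eventually_abs_re_le_verticalInfinity {ε : ℝ} (hε : 0 < ε) :
    ∀ᶠ z in verticalInfinity, |z.re| ≤ ε * |z.im| :=
  (tendsto_verticalInfinity_iff.1 tendsto_id).2 ε hε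

/-- The principal filter on [0,1] encodes uniformity in the shift parameter, needed to pass to the
limit under an integral over it. -/
lemma tendsto_add_smul_verticalInfinity (v : ℂ) :
    Tendsto (fun p : ℂ × ℝ => p.1 + p.2 * v) (verticalInfinity ×ˢ 𝓟 (Set.Icc 0 1))
      verticalInfinity := by
  have hs : ∀ᶠ p : ℂ × ℝ in verticalInfinity ×ˢ 𝓟 (Set.Icc (0 : ℝ) 1), |p.2| ≤ 1 := by
    have : ∀ᶠ s : ℝ in 𝓟 (Set.Icc (0 : ℝ) 1), |s| ≤ 1 := by
      rw [eventually_principal]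
      rintro s ⟨h0, h1⟩
      rwa [abs_of_nonneg h0]
    exact this.prod_inr _
  have hb : ∀ᶠ p : ℂ × ℝ in verticalInfinity ×ˢ 𝓟 (Set.Icc (0 : ℝ) 1),
      |(p.1 + p.2 * v).re| ≤ |p.1.re| + |v.re| ∧ |p.1.im| - |v.im| ≤ |(p.1 + p.2 * v).im| := by
    filter_upwards [hs] with p hp
    have h1 : |p.2 * v.re| ≤ |v.re| := by
      rw [abs_mul]; exact mul_le_of_le_one_left (abs_nonneg _) hp
    have h2 : |p.2 * v.im| ≤ |v.im| := by
      rw [abs_mul]; exact mul_le_of_le_one_left (abs_nonneg _) hp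
    simp only [Complex.add_re, Complex.mul_re, Complex.ofReal_re, Complex.ofReal_im, zero_mul,
      sub_zero, Complex.add_im, Complex.mul_im, add_zero]
    constructor
    · exact (abs_add_le _ _).trans (by gcongr)
    · have := abs_sub_abs_le_abs_sub p.1.im (-(p.2 * v.im))
      rw [abs_neg, sub_neg_eq_add] at this
      linarith
  have hfst : Tendsto (fun p : ℂ × ℝ => |p.1.im|)
      (verticalInfinity ×ˢ 𝓟 (Set.Icc (0 : ℝ) 1)) atTop :=
    tendsto_abs_im_verticalInfinity.comp tendsto_fst
  rw [tendsto_verticalInfinity_iff]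
  constructor
  · refine tendsto_atTop_mono' _ (hb.mono fun p hp => hp.2) ?_
    exact tendsto_atTop_add_const_right _ _ hfst
  · intro ε hε
    have h1 := (eventually_abs_re_le_verticalInfinity (half_pos hε)).prod_inl
      (𝓟 (Set.Icc (0 : ℝ) 1))
    filter_upwards [hb, h1, hfst.eventually_ge_atTop ((|v.re| + ε * |v.im|) / (ε / 2))]
      with p hp h1 h2
    rw [div_le_iff₀ (half_pos hε)] at h2
    nlinarith [hp.1, hp.2]

lemma tendsto_add_const_verticalInfinity (v : ℂ) :
    Tendsto (fun z => z + v) verticalInfinity verticalInfinity := by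
  have h1 : Tendsto (fun _ : ℂ => (1 : ℝ)) verticalInfinity (𝓟 (Set.Icc 0 1)) :=
    tendsto_principal.2 (Eventually.of_forall fun _ => by simp)
  simpa [Function.comp_def] using
    (tendsto_add_smul_verticalInfinity v).comp (tendsto_id.prodMk h1)

lemma tendsto_neg_verticalInfinity :
    Tendsto (fun z : ℂ => -z) verticalInfinity verticalInfinity := by
  rw [tendsto_verticalInfinity_iff]
  simpa using ⟨tendsto_abs_im_verticalInfinity, fun ε => eventually_abs_re_le_verticalInfinity⟩

lemma IsVerticalContour.tendsto_atTop {γ : ℝ → ℂ} (hγ : IsVerticalContour γ) :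
    Tendsto γ atTop verticalInfinity := by
  rw [verticalInfinity, tendsto_inf, tendsto_comap_iff, tendsto_comap_iff]
  exact ⟨tendsto_abs_atTop_atTop.comp hγ.im_atTop, hγ.direction_atTop⟩

lemma IsVerticalContour.tendsto_atBot {γ : ℝ → ℂ} (hγ : IsVerticalContour γ) :
    Tendsto γ atBot verticalInfinity := by
  rw [verticalInfinity, tendsto_inf, tendsto_comap_iff, tendsto_comap_iff]
  exact ⟨tendsto_abs_atBot_atTop.comp hγ.im_atBot, hγ.direction_atBot⟩

/-! ### Contour integrals of translation differences. -/

namespace HasContourIntegral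

variable {f g : ℂ → ℂ} {γ : ℝ → ℂ} {I J : ℂ}

lemma add (hf : HasContourIntegral f γ I) (hg : HasContourIntegral g γ J) :
    HasContourIntegral (fun z => f z + g z) γ (I + J) := by
  refine ⟨fun a b => ?_, ?_⟩
  · simpa only [add_mul] using (hf.1 a b).add (hg.1 a b)
  · convert hf.2.add hg.2 using 2 with p
    simp only [add_mul]
    exact intervalIntegral.integral_add (hf.1 _ _) (hg.1 _ _)

lemma const_mul (a : ℂ) (hf : HasContourIntegral f γ I) :
    HasContourIntegral (fun z => a * f z) γ (a * I) := by
  refine ⟨fun x y => ?_, ?_⟩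
  · simpa only [mul_assoc] using (hf.1 x y).const_mul a
  · convert hf.2.const_mul a using 2 with p
    simp only [mul_assoc]
    exact intervalIntegral.integral_const_mul _ _

lemma zero : HasContourIntegral (fun _ => 0) γ 0 := by
  simp [HasContourIntegral]

lemma sum {ι : Type*} (s : Finset ι) {f : ι → ℂ → ℂ}
    (h : ∀ i ∈ s, HasContourIntegral (f i) γ 0) :
    HasContourIntegral (fun z => ∑ i ∈ s, f i z) γ 0 := by
  classical
  induction s using Finset.induction_on with
  | empty => simpa using zero
  | insert i s hi ih =>
    simp only [Finset.sum_insert hi]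
    simpa using (h i (Finset.mem_insert_self i s)).add
      (ih fun j hj => h j (Finset.mem_insert_of_mem hj))

lemma congr (hf : HasContourIntegral f γ I) (h : ∀ t, f (γ t) = g (γ t)) :
    HasContourIntegral g γ I := by
  simpa only [HasContourIntegral, h] using hf

/-- The integral of a translation difference vanishes if the function is holomorphic on all the
intermediate translates of the contour. -/
theorem translate_sub (hγ : IsVerticalContour γ) {Ω : Set ℂ} (hΩ : IsOpen Ω)
    (hg : DifferentiableOn ℂ g Ω) (hlim : Tendsto g verticalInfinity (𝓝 0)) (v : ℂ)
    (hmem : ∀ t, ∀ s ∈ Set.Icc (0 : ℝ) 1, γ t + s * v ∈ Ω) :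
    HasContourIntegral (fun z => g (z + v) - g z) γ 0 := by
  -- The average of g over the segment from z to z + v, times v, is a primitive of g(z+v) - g(z)
  -- near the contour.
  let Q : ℂ → ℂ := fun z => ∫ s in (0 : ℝ)..1, v * g (z + s * v)
  have hgc : ContinuousOn g Ω := hg.continuousOn
  have hg' : ContinuousOn (deriv g) Ω := (hg.deriv hΩ).continuousOn
  have hQ : ∀ t, HasDerivAt Q (g (γ t + v) - g (γ t)) (γ t) := by
    intro t
    set z₀ := γ t with hz₀
    have hz : ∀ s ∈ Set.Icc (0 : ℝ) 1, z₀ + s * v ∈ Ω := hmem t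
    set K := (fun s : ℝ => z₀ + s * v) '' Set.Icc (0 : ℝ) 1 with hK
    have hline : ∀ z : ℂ, Continuous fun s : ℝ => z + s * v := fun z => by fun_prop
    have hKc : IsCompact K := isCompact_Icc.image (hline z₀)
    -- A compact neighbourhood of the segment bounds g' uniformly, as differentiation under the
    -- integral requires.
    obtain ⟨δ, hδ, hδΩ⟩ := hKc.exists_cthickening_subset_open hΩ (by
      rintro _ ⟨s, hs, rfl⟩; exact hz s hs)
    have hin : ∀ z ∈ Metric.ball z₀ δ, ∀ s ∈ Set.Icc (0 : ℝ) 1,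
        z + s * v ∈ Metric.cthickening δ K := by
      intro z hz s hs
      refine Metric.mem_cthickening_of_dist_le _ (z₀ + s * v) _ _ ⟨s, hs, rfl⟩ ?_
      rw [dist_add_right]
      exact (Metric.mem_ball.1 hz).le
    obtain ⟨M, hM⟩ := hKc.cthickening.exists_bound_of_continuousOn (hg'.mono hδΩ)
    have hsub : Set.uIoc (0 : ℝ) 1 ⊆ Set.Icc 0 1 := by
      rw [Set.uIoc_of_le zero_le_one]; exact Set.Ioc_subset_Icc_self
    have huIcc : Set.uIcc (0 : ℝ) 1 = Set.Icc 0 1 := Set.uIcc_of_le zero_le_one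
    have hcont : ∀ z ∈ Metric.ball z₀ δ,
        ContinuousOn (fun s : ℝ => v * g (z + s * v)) (Set.Icc 0 1) := fun z hz =>
      continuousOn_const.mul (hgc.comp (hline z).continuousOn fun s hs => hδΩ (hin z hz s hs))
    have hcont' : ContinuousOn (fun s : ℝ => v * deriv g (z₀ + s * v)) (Set.Icc 0 1) :=
      continuousOn_const.mul (hg'.comp (hline z₀).continuousOn fun s hs => hz s hs)
    have hder : ∀ w ∈ Ω, HasDerivAt g (deriv g w) w := fun w hw =>
      (hg.differentiableAt (hΩ.mem_nhds hw)).hasDerivAt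
    have key := intervalIntegral.hasDerivAt_integral_of_dominated_loc_of_deriv_le
      (μ := volume) (a := 0) (b := 1) (F := fun z (s : ℝ) => v * g (z + s * v))
      (F' := fun z (s : ℝ) => v * deriv g (z + s * v)) (bound := fun _ => ‖v‖ * M)
      (Metric.ball_mem_nhds z₀ hδ)
      (by
        filter_upwards [Metric.ball_mem_nhds z₀ hδ] with z hz
        exact ((hcont z hz).mono hsub).aestronglyMeasurable measurableSet_uIoc)
      (by
        refine ContinuousOn.intervalIntegrable ?_
        rw [huIcc]; exact hcont z₀ (Metric.mem_ball_self hδ))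
      ((hcont'.mono hsub).aestronglyMeasurable measurableSet_uIoc)
      (by
        refine Eventually.of_forall fun s hs z hz => ?_
        rw [norm_mul]
        gcongr
        exact hM _ (hin z hz s (hsub hs)))
      intervalIntegrable_const
      (by
        refine Eventually.of_forall fun s hs z hz => ?_
        exact ((hder _ (hδΩ (hin z hz s (hsub hs)))).comp_add_const z (s * v)).const_mul v)
    have hFTC := intervalIntegral.integral_eq_sub_of_hasDerivAt
      (a := 0) (b := 1) (f := fun s : ℝ => g (z₀ + s * v))
      (f' := fun s : ℝ => v * deriv g (z₀ + s * v)) (fun s hs => by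
        rw [huIcc] at hs
        have h1 : HasDerivAt (fun s : ℝ => z₀ + s * v) v s := by
          simpa using ((Complex.ofRealCLM.hasDerivAt (x := s)).mul_const v).const_add z₀
        have := (hder _ (hz s hs)).comp s h1
        simpa [mul_comm, Function.comp_def] using this)
      (by refine ContinuousOn.intervalIntegrable ?_; rw [huIcc]; exact hcont')
    simp only [Complex.ofReal_one, one_mul, Complex.ofReal_zero, zero_mul, add_zero] at hFTC
    exact hFTC ▸ key.2
  have hint : ∀ a b : ℝ, IntervalIntegrable
      (fun t => (g (γ t + v) - g (γ t)) * deriv γ t) volume a b := by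
    intro a b
    refine (hγ.integrable_deriv a b).continuousOn_mul (Continuous.continuousOn ?_)
    have h0 : ∀ t, γ t ∈ Ω := fun t => by simpa using hmem t 0 (by simp)
    have h1 : ∀ t, γ t + v ∈ Ω := fun t => by simpa using hmem t 1 (by simp)
    exact (hgc.comp_continuous (hγ.continuous.add continuous_const) h1).sub
      (hgc.comp_continuous hγ.continuous h0)
  refine ⟨hint, ?_⟩
  obtain ⟨S, hS, hd⟩ := hγ.differentiable
  have hval : ∀ a b : ℝ, ∫ t in a..b, (g (γ t + v) - g (γ t)) * deriv γ t =
      Q (γ b) - Q (γ a) := fun a b =>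
    integral_eq_of_hasDerivAt_off_countable (fun t => Q (γ t)) _ hS
      (Continuous.continuousOn (continuous_iff_continuousAt.2 fun t =>
        (hQ t).continuousAt.comp hγ.continuous.continuousAt))
      (fun t ht => (hQ t).comp t (hd t ht.2).hasDerivAt) (hint a b)
  have hQlim : Tendsto Q verticalInfinity (𝓝 0) := by
    rw [Metric.tendsto_nhds]
    intro ε hε
    have hη : 0 < ε / (2 * (‖v‖ + 1)) := by positivity
    have h := (Metric.tendsto_nhds.1 (hlim.comp (tendsto_add_smul_verticalInfinity v)) _ hη)
    rw [eventually_prod_principal_iff] at h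
    filter_upwards [h] with z hz
    rw [dist_zero_right]
    have hb : ‖Q z‖ ≤ (‖v‖ * (ε / (2 * (‖v‖ + 1)))) * |(1 : ℝ) - 0| := by
      refine intervalIntegral.norm_integral_le_of_norm_le_const fun s hs => ?_
      rw [Set.uIoc_of_le zero_le_one] at hs
      have := hz s (Set.Ioc_subset_Icc_self hs)
      simp only [Function.comp_apply, dist_zero_right] at this
      rw [norm_mul]
      gcongr
    have h2 : ‖v‖ * (ε / (2 * (‖v‖ + 1))) ≤ ε / 2 := by
      rw [mul_div_assoc', div_le_div_iff₀ (by positivity) (by positivity)]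
      nlinarith [norm_nonneg v]
    simp only [sub_zero, abs_one, mul_one] at hb
    linarith
  simp only [hval]
  have := (hQlim.comp (hγ.tendsto_atTop.comp tendsto_snd)).sub
    (hQlim.comp (hγ.tendsto_atBot.comp (tendsto_fst (g := (atTop : Filter ℝ)))))
  simpa [Function.comp_def] using this

end HasContourIntegral

/-! ### Simple poles swept by the translation. -/

lemma tendsto_inv_sub_verticalInfinity (p : ℂ) :
    Tendsto (fun z => (z - p)⁻¹) verticalInfinity (𝓝 0) := by
  have h : Tendsto (fun z : ℂ => z) verticalInfinity (Bornology.cobounded ℂ) := by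
    rw [← tendsto_norm_atTop_iff_cobounded]
    exact tendsto_atTop_mono Complex.abs_im_le_norm tendsto_abs_im_verticalInfinity
  simpa [Function.comp_def, sub_eq_add_neg] using
    (tendsto_inv₀_cobounded.comp h).comp (tendsto_add_const_verticalInfinity (-p))

/-- A kernel with a simple pole at `0` that decays in the vertical directions. -/
noncomputable def gaussianPole (z : ℂ) : ℂ := Complex.exp (z ^ 2) / z

lemma differentiableOn_gaussianPole : DifferentiableOn ℂ gaussianPole {0}ᶜ := by
  unfold gaussianPole
  exact DifferentiableOn.div (by fun_prop) differentiableOn_id fun z hz => hz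

lemma tendsto_gaussianPole : Tendsto gaussianPole verticalInfinity (𝓝 0) := by
  refine squeeze_zero_norm' ?_ (by simpa using (tendsto_inv_sub_verticalInfinity 0).norm)
  filter_upwards [eventually_abs_re_le_verticalInfinity one_pos] with z hz
  rw [gaussianPole, norm_div, Complex.norm_exp, div_eq_mul_inv]
  refine mul_le_of_le_one_left (by positivity) (Real.exp_le_one_iff.2 ?_)
  rw [one_mul] at hz
  have := sq_le_sq.2 hz
  simp only [sq, Complex.mul_re] at this ⊢
  linarith

namespace HasContourIntegral

variable {γ : ℝ → ℂ}

/-- Equality of the integrals for two pole positions is an equivalence relation that holds locally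
off the closed curve, so it holds throughout a preconnected set. -/
lemma gaussianPole_sub (hγ : IsVerticalContour γ) {U : Set ℂ} (hU : IsPreconnected U)
    (hUγ : U ⊆ (Set.range γ)ᶜ) (hcl : IsClosed (Set.range γ)) {p q : ℂ} (hp : p ∈ U)
    (hq : q ∈ U) :
    HasContourIntegral (fun z => gaussianPole (z - p) - gaussianPole (z - q)) γ 0 := by
  refine hU.induction₂ (fun p q => HasContourIntegral
    (fun z => gaussianPole (z - p) - gaussianPole (z - q)) γ 0) ?_ ?_ ?_ hp hq
  · intro x hx
    obtain ⟨δ, hδ, hb⟩ := Metric.isOpen_iff.1 hcl.isOpen_compl x (hUγ hx)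
    filter_upwards [mem_nhdsWithin_of_mem_nhds (Metric.ball_mem_nhds x hδ)] with y hy
    -- Moving the pole from y to x amounts to translating the argument by y - x. If a translate γ t
    -- + s(y-x) hit y, then γ t would lie within |y-x| < δ of x, in a ball that misses the curve.
    have h := translate_sub hγ (Ω := {y}ᶜ) (g := fun z => gaussianPole (z - y))
      isOpen_compl_singleton
      (differentiableOn_gaussianPole.comp (by fun_prop) fun z hz => sub_ne_zero.2 hz)
      (by simpa [Function.comp_def, sub_eq_add_neg] using
        tendsto_gaussianPole.comp (tendsto_add_const_verticalInfinity (-y))) (y - x) (by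
        intro t s hs heq
        refine hb (a := γ t) ?_ ⟨t, rfl⟩
        have h1 : γ t - x = ((1 - s : ℝ) : ℂ) * (y - x) := by
          rw [Set.mem_singleton_iff] at heq
          push_cast
          linear_combination heq
        rw [Metric.mem_ball, dist_eq_norm, h1, norm_mul, Complex.norm_real, Real.norm_eq_abs,
          abs_of_nonneg (by linarith [hs.2])]
        rw [Metric.mem_ball, dist_eq_norm] at hy
        nlinarith [hs.1, norm_nonneg (y - x)])
    exact h.congr fun t => by rw [show γ t + (y - x) - y = γ t - x by ring]
  · intro x y z _ _ _ hxy hyz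
    simpa using hxy.add hyz
  · intro x y _ _ hxy
    simpa using hxy.const_mul (-1)

theorem translate_sub_of_simple_pole (hγ : IsVerticalContour γ)
    (hcl : IsClosed (Set.range γ)) {Ω : Set ℂ} (hΩ : IsOpen Ω) {E : ℂ → ℂ}
    (hE : DifferentiableOn ℂ E Ω) (hlim : Tendsto E verticalInfinity (𝓝 0))
    (hmem : ∀ t, ∀ s ∈ Set.Icc (0 : ℝ) 1, γ t + s ∈ Ω) {p : ℂ} (hpΩ : p ∈ Ω)
    {U : Set ℂ} (hU : IsPreconnected U) (hUγ : U ⊆ (Set.range γ)ᶜ) (hp : p ∈ U)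
    (hp' : p - 1 ∈ U) :
    HasContourIntegral (fun z => E (z + 1) / (z + 1 - p) - E z / (z - p)) γ 0 := by
  -- This vanishes at p, so `dslope f p` is E(z)/(z-p) with its pole removed by a multiple of the
  -- model kernel.
  let f : ℂ → ℂ := fun z => E z - E p * Complex.exp ((z - p) ^ 2)
  have hf : DifferentiableOn ℂ f Ω := by fun_prop
  have hR : ∀ z, z ≠ p → dslope f p z = E z / (z - p) - E p * gaussianPole (z - p) := by
    intro z hz
    rw [dslope_of_ne _ hz, slope_def_field, gaussianPole]
    simp [f, sub_div, mul_div_assoc]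
  have hRlim : Tendsto (dslope f p) verticalInfinity (𝓝 0) := by
    have h1 := hlim.mul (tendsto_inv_sub_verticalInfinity p)
    have h2 := (tendsto_gaussianPole.comp (tendsto_add_const_verticalInfinity (-p))).const_mul
      (E p)
    have h3 := h1.sub h2
    simp only [mul_zero, sub_zero] at h3
    refine h3.congr' ?_
    filter_upwards [tendsto_abs_im_verticalInfinity.eventually_gt_atTop |p.im|] with z hz
    rw [hR z (by rintro rfl; exact lt_irrefl _ hz), div_eq_mul_inv]
    simp [sub_eq_add_neg]
  have h1 := translate_sub hγ hΩ
    ((Complex.differentiableOn_dslope (hΩ.mem_nhds hpΩ)).2 hf) hRlim 1 (by simpa using hmem)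
  have h2 := (gaussianPole_sub hγ hU hUγ hcl hp' hp).const_mul (E p)
  have h3 := h1.add h2
  simp only [mul_zero, add_zero] at h3
  refine h3.congr fun t => ?_
  have n1 : γ t ≠ p := fun h => hUγ hp ⟨t, h⟩
  have n2 : γ t + 1 ≠ p := fun h => hUγ hp' ⟨t, by rw [← h]; ring⟩
  rw [hR _ n1, hR _ n2, show γ t - (p - 1) = γ t + 1 - p by ring]
  ring

theorem translate_sub_of_simple_poles (hγ : IsVerticalContour γ)
    (hcl : IsClosed (Set.range γ)) {Ω : Set ℂ} (hΩ : IsOpen Ω) {E : ℂ → ℂ}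
    (hE : DifferentiableOn ℂ E Ω) (hlim : Tendsto E verticalInfinity (𝓝 0))
    (hmem : ∀ t, ∀ s ∈ Set.Icc (0 : ℝ) 1, γ t + s ∈ Ω) {ι : Type*} [DecidableEq ι]
    {S : Finset ι} (hS : S.Nonempty) {v : ι → ℂ} (hv : Set.InjOn v S)
    (hvΩ : ∀ i ∈ S, v i ∈ Ω)
    (hU : ∀ i ∈ S, ∃ U : Set ℂ, IsPreconnected U ∧ U ⊆ (Set.range γ)ᶜ ∧ v i ∈ U ∧ v i - 1 ∈ U) :
    HasContourIntegral
      (fun z => E (z + 1) / ∏ i ∈ S, (z + 1 - v i) - E z / ∏ i ∈ S, (z - v i)) γ 0 := by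
  have hne : ∀ t, ∀ i ∈ S, γ t ≠ v i := by
    intro t i hi h
    obtain ⟨U, -, hUγ, hp, -⟩ := hU i hi
    exact hUγ hp ⟨t, h⟩
  have hne' : ∀ t, ∀ i ∈ S, γ t + 1 ≠ v i := by
    intro t i hi h
    obtain ⟨U, -, hUγ, -, hp⟩ := hU i hi
    exact hUγ hp ⟨t, by rw [← h]; ring⟩
  -- Partial fractions, read off from Lagrange interpolation of the constant 1.
  have hpf : ∀ x : ℂ, (∀ i ∈ S, x ≠ v i) → E x / ∏ i ∈ S, (x - v i) =
      ∑ i ∈ S, Lagrange.nodalWeight S v i * (E x / (x - v i)) := by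
    intro x hx
    have h := Lagrange.eval_interpolate_not_at_node (s := S) (v := v) (x := x) (1 : ι → ℂ) hx
    rw [Lagrange.interpolate_one hv hS, Polynomial.eval_one, Lagrange.eval_nodal] at h
    have h0 : ∏ i ∈ S, (x - v i) ≠ 0 :=
      Finset.prod_ne_zero_iff.2 fun i hi => sub_ne_zero.2 (hx i hi)
    rw [div_eq_iff h0]
    calc E x = E x * ((∏ i ∈ S, (x - v i)) *
          ∑ i ∈ S, Lagrange.nodalWeight S v i * (x - v i)⁻¹ * (1 : ι → ℂ) i) := by
          rw [← h, mul_one]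
      _ = _ := by
          simp only [Pi.one_apply, Finset.mul_sum, Finset.sum_mul]
          refine Finset.sum_congr rfl fun i _ => ?_
          ring
  refine (sum S fun i hi => ?_ : HasContourIntegral (fun z => ∑ i ∈ S,
    Lagrange.nodalWeight S v i * (E (z + 1) / (z + 1 - v i) - E z / (z - v i))) γ 0).congr ?_
  · obtain ⟨U, h1, h2, h3, h4⟩ := hU i hi
    simpa using (translate_sub_of_simple_pole hγ hcl hΩ hE hlim hmem (hvΩ i hi) h1 h2 h3
      h4).const_mul (Lagrange.nodalWeight S v i)
  · intro t
    rw [hpf _ (hne t), hpf _ (hne' t), ← Finset.sum_sub_distrib]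
    simp only [mul_sub]

end HasContourIntegral

/-- Escape to infinity at both ends makes the curve a proper map. -/
lemma IsVerticalContour.isClosed_range {γ : ℝ → ℂ} (hγ : IsVerticalContour γ) :
    IsClosed (Set.range γ) := by
  have h : Tendsto (fun t => ‖γ t‖) (cocompact ℝ) atTop := by
    rw [cocompact_eq_atBot_atTop, tendsto_sup]
    exact ⟨tendsto_atTop_mono (fun t => Complex.abs_im_le_norm _)
        (tendsto_abs_atBot_atTop.comp hγ.im_atBot),
      tendsto_atTop_mono (fun t => Complex.abs_im_le_norm _)
        (tendsto_abs_atTop_atTop.comp hγ.im_atTop)⟩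
  have h' : Tendsto γ (cocompact ℝ) (cocompact ℂ) := by
    rw [← Metric.cobounded_eq_cocompact (α := ℂ)]
    exact tendsto_norm_atTop_iff_cobounded.1 h
  exact (isProperMap_iff_tendsto_cocompact.2 ⟨hγ.continuous, h'⟩).isClosedMap.isClosed_range

/-! ### Exponential decay of products of Gamma functions. -/

lemma polynomial_eval_isBigO_exp_im (P : Polynomial ℂ) {ε : ℝ} (hε : 0 < ε) :
    (fun z => P.eval z) =O[verticalInfinity] fun z => Real.exp (ε * |z.im|) := by
  induction P using Polynomial.induction_on' with
  | add P Q hP hQ => simpa only [Polynomial.eval_add] using hP.add hQ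
  | monomial n a =>
    simp only [Polynomial.eval_monomial]
    refine Asymptotics.IsBigO.const_mul_left ?_ a
    have h1 : (fun z : ℂ => z ^ n) =O[verticalInfinity] fun z => |z.im| ^ n := by
      refine Asymptotics.IsBigO.pow (Asymptotics.IsBigO.of_bound 2 ?_) n
      filter_upwards [eventually_abs_re_le_verticalInfinity one_pos] with z hz
      rw [Real.norm_eq_abs, abs_abs]
      linarith [Complex.norm_le_abs_re_add_abs_im z]
    exact h1.trans ((isLittleO_pow_exp_pos_mul_atTop n hε).comp_tendsto
      tendsto_abs_im_verticalInfinity).isBigO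

lemma exp_mul_isBigO_exp_im (l : ℂ) {ε : ℝ} (hε : 0 < ε) :
    (fun z => Complex.exp (l * z)) =O[verticalInfinity]
      fun z => Real.exp ((|l.im| + ε) * |z.im|) := by
  refine Asymptotics.IsBigO.of_bound 1 ?_
  filter_upwards [eventually_abs_re_le_verticalInfinity
    (ε := ε / (|l.re| + 1)) (by positivity)] with z hz
  rw [Complex.norm_exp, Real.norm_eq_abs, Real.abs_exp, one_mul, Real.exp_le_exp, Complex.mul_re]
  have h1 : l.re * z.re ≤ |l.re| * |z.re| := by rw [← abs_mul]; exact le_abs_self _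
  have h2 : -(l.im * z.im) ≤ |l.im| * |z.im| := by rw [← abs_mul]; exact neg_le_abs _
  have h3 : |l.re| * |z.re| ≤ ε * |z.im| := by
    calc |l.re| * |z.re| ≤ (|l.re| + 1) * (ε / (|l.re| + 1) * |z.im|) := by gcongr; linarith
      _ = ε * |z.im| := by field_simp
  linarith

lemma exp_abs_im_le_norm_sin {w : ℂ} (hw : 1 ≤ |w.im|) :
    Real.exp |w.im| / 4 ≤ ‖Complex.sin w‖ := by
  have h : ‖Complex.sin w‖ = ‖Complex.exp (-w * Complex.I) - Complex.exp (w * Complex.I)‖ / 2 := by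
    simp [Complex.sin]
  have h1 := abs_norm_sub_norm_le (Complex.exp (-w * Complex.I)) (Complex.exp (w * Complex.I))
  have h2 : |Real.exp w.im - Real.exp (-w.im)| = Real.exp |w.im| - Real.exp (-|w.im|) := by
    rcases le_total 0 w.im with h0 | h0
    · rw [abs_of_nonneg h0, abs_of_nonneg (sub_nonneg.2 (Real.exp_le_exp.2 (by linarith)))]
    · rw [abs_of_nonpos h0, abs_of_nonpos (sub_nonpos.2 (Real.exp_le_exp.2 (by linarith)))]
      rw [neg_neg]
      ring
  simp only [Complex.norm_exp, Complex.mul_re, Complex.neg_re, Complex.I_re, mul_zero,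
    Complex.neg_im, Complex.I_im, mul_one, zero_sub, neg_neg, h2] at h1
  have h3 : Real.exp (-|w.im|) ≤ 1 := Real.exp_le_one_iff.2 (by linarith)
  have h4 := Real.add_one_le_exp |w.im|
  rw [h]
  linarith

lemma inv_sin_pi_mul_isBigO_exp_im (b : ℂ) :
    (fun z => (Complex.sin (Real.pi * (z + b)))⁻¹) =O[verticalInfinity]
      fun z => Real.exp (-Real.pi * |z.im|) := by
  refine Asymptotics.IsBigO.of_bound (4 * Real.exp (Real.pi * |b.im|)) ?_
  filter_upwards [tendsto_abs_im_verticalInfinity.eventually_ge_atTop (1 + |b.im|)] with z hz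
  have hpi := Real.pi_gt_three
  have him : |(Real.pi * (z + b) : ℂ).im| = Real.pi * |z.im + b.im| := by
    simp [abs_mul, abs_of_pos Real.pi_pos]
  have h1 : |z.im| - |b.im| ≤ |z.im + b.im| := by
    simpa using abs_sub_abs_le_abs_sub z.im (-b.im)
  have h2 := exp_abs_im_le_norm_sin (w := Real.pi * (z + b)) (by rw [him]; nlinarith)
  rw [him] at h2
  have h3 : Real.exp (Real.pi * |z.im| - Real.pi * |b.im|) ≤
      Real.exp (Real.pi * |z.im + b.im|) := Real.exp_le_exp.2 (by nlinarith)
  rw [norm_inv, Real.norm_eq_abs, Real.abs_exp, mul_assoc, ← Real.exp_add,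
    inv_le_iff_one_le_mul₀ (lt_of_lt_of_le (by positivity) h2)]
  have h4 : Real.exp (Real.pi * |b.im| + -Real.pi * |z.im|) *
      Real.exp (Real.pi * |z.im| - Real.pi * |b.im|) = 1 := by
    rw [← Real.exp_add, ← Real.exp_zero]
    congr 1
    ring
  have h5 : Real.exp (Real.pi * |z.im| - Real.pi * |b.im|) ≤
      4 * ‖Complex.sin (Real.pi * (z + b))‖ := by linarith
  calc (1 : ℝ) = _ := h4.symm
    _ ≤ Real.exp (Real.pi * |b.im| + -Real.pi * |z.im|) *
        (4 * ‖Complex.sin (Real.pi * (z + b))‖) := by gcongr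
    _ = _ := by ring

lemma norm_betaIntegral_le_one {u v : ℂ} (hu : 1 ≤ u.re) (hv : 1 ≤ v.re) :
    ‖Complex.betaIntegral u v‖ ≤ 1 := by
  have : ‖Complex.betaIntegral u v‖ ≤ 1 * |(1 : ℝ) - 0| := by
    refine intervalIntegral.norm_integral_le_of_norm_le_const_ae ?_
    have h1 : ∀ᵐ x : ℝ, x ≠ 1 := by simp [ae_iff, measure_singleton]
    filter_upwards [h1] with x hx1 hx
    rw [Set.uIoc_of_le zero_le_one] at hx
    have hx' : 0 < 1 - x := sub_pos.2 (lt_of_le_of_ne hx.2 hx1)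
    rw [norm_mul, Complex.norm_cpow_eq_rpow_re_of_pos hx.1, ← Complex.ofReal_one,
      ← Complex.ofReal_sub, Complex.norm_cpow_eq_rpow_re_of_pos hx']
    refine mul_le_one₀ (Real.rpow_le_one hx.1.le hx.2 ?_) (by positivity)
      (Real.rpow_le_one hx'.le (by linarith [hx.1]) ?_)
    · simpa using hu
    · simpa using hv
  simpa using this

/-- Γ(w+d) Γ(M-d) = Γ(w+M) B(w+d, M-d), and the Beta integrand is at most 1 in norm almost
everywhere. This replaces an arbitrary shift d by an integer one, uniformly in w. -/
lemma norm_Gamma_add_le {d : ℂ} {M : ℕ} (hM : 1 ≤ (M - d).re) {w : ℂ} (hw : 1 ≤ (w + d).re) :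
    ‖Complex.Gamma (w + d)‖ ≤ ‖Complex.Gamma (M - d)‖⁻¹ * ‖Complex.Gamma (w + M)‖ := by
  have h := Complex.Gamma_mul_Gamma_eq_betaIntegral (lt_of_lt_of_le one_pos hw)
    (lt_of_lt_of_le one_pos hM)
  rw [show w + d + (M - d) = w + M by ring] at h
  have h0 : 0 < ‖Complex.Gamma (M - d)‖ :=
    norm_pos_iff.2 (Complex.Gamma_ne_zero_of_re_pos (lt_of_lt_of_le one_pos hM))
  have h1 := congrArg norm h
  rw [norm_mul, norm_mul] at h1
  rw [inv_mul_eq_div, le_div_iff₀ h0, h1]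
  exact mul_le_of_le_one_right (norm_nonneg _) (norm_betaIntegral_le_one hw hM)

lemma Gamma_add_natCast {w : ℂ} (hw : ∀ k : ℕ, w ≠ -k) (M : ℕ) :
    Complex.Gamma (w + M) = (ascPochhammer ℂ M).eval w * Complex.Gamma w := by
  rw [← Complex.Gamma_add_nat_div_Gamma_eq w hw, div_mul_cancel₀ _ (Complex.Gamma_ne_zero hw)]

/-- With w = z + 1 - a, the Gamma product is (w)_M π / sin(πw) by reflection; the sine gives
e^{-π|Im z|}, which beats the exponential factor. -/
lemma Gamma_reflection_isBigO_exp_im (a l : ℂ) (M : ℕ) {δ : ℝ} (hδ : δ + |l.im| < Real.pi) :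
    (fun z => Complex.Gamma (z + (1 - a) + M) * Complex.Gamma (a - z) * Complex.exp (l * z))
      =O[verticalInfinity] fun z => Real.exp (-δ * |z.im|) := by
  set ε := (Real.pi - δ - |l.im|) / 2 with hε
  have hε0 : 0 < ε := by rw [hε]; linarith
  have h := ((polynomial_eval_isBigO_exp_im ((ascPochhammer ℂ M).comp
    (Polynomial.X + Polynomial.C (1 - a))) hε0).mul (inv_sin_pi_mul_isBigO_exp_im (1 - a))).mul
    (exp_mul_isBigO_exp_im l hε0)
  refine ((h.const_mul_left (Real.pi : ℂ)).congr' ?_ ?_)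
  · filter_upwards [tendsto_abs_im_verticalInfinity.eventually_gt_atTop |a.im|] with z hz
    have hw : ∀ k : ℕ, z + (1 - a) ≠ -k := by
      intro k hk
      have := congrArg Complex.im hk
      simp only [Complex.add_im, Complex.sub_im, Complex.one_im, Complex.neg_im,
        Complex.natCast_im] at this
      rw [show z.im = a.im by linarith] at hz
      exact lt_irrefl _ hz
    have hr := Complex.Gamma_mul_Gamma_one_sub (z + (1 - a))
    rw [show 1 - (z + (1 - a)) = a - z by ring] at hr
    rw [Gamma_add_natCast hw, mul_assoc _ (Complex.Gamma _) (Complex.Gamma _), hr]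
    simp only [Polynomial.eval_comp, Polynomial.eval_add, Polynomial.eval_X, Polynomial.eval_C]
    ring
  · refine Eventually.of_forall fun z => ?_
    simp only [← Real.exp_add]
    congr 1
    rw [hε]
    ring

lemma Gamma_mul_Gamma_bound_of_one_le_re (a b l : ℂ) {δ : ℝ} (hδ : δ + |l.im| < Real.pi) :
    ∃ C : ℝ, ∀ᶠ z in verticalInfinity, 1 ≤ (b + z).re →
      ‖Complex.Gamma (a - z) * Complex.Gamma (b + z) * Complex.exp (l * z)‖ ≤
        C * Real.exp (-δ * |z.im|) := by
  obtain ⟨M, hM⟩ := exists_nat_ge (a + b).re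
  obtain ⟨C, hC⟩ := (Gamma_reflection_isBigO_exp_im a l M hδ).bound
  refine ⟨‖Complex.Gamma (M - (a + b - 1))‖⁻¹ * C, ?_⟩
  filter_upwards [hC] with z hz hre
  have h := norm_Gamma_add_le (d := a + b - 1) (M := M) (w := z + (1 - a))
    (by simp only [Complex.add_re, Complex.sub_re, Complex.natCast_re, Complex.one_re] at hM ⊢
        linarith)
    (by rwa [show z + (1 - a) + (a + b - 1) = b + z by ring])
  rw [show z + (1 - a) + (a + b - 1) = b + z by ring] at h
  rw [Real.norm_eq_abs, Real.abs_exp] at hz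
  calc _ = ‖Complex.Gamma (b + z)‖ * (‖Complex.Gamma (a - z)‖ * ‖Complex.exp (l * z)‖) := by
        rw [norm_mul, norm_mul]; ring
    _ ≤ (‖Complex.Gamma (M - (a + b - 1))‖⁻¹ * ‖Complex.Gamma (z + (1 - a) + M)‖) *
        (‖Complex.Gamma (a - z)‖ * ‖Complex.exp (l * z)‖) := by gcongr
    _ = ‖Complex.Gamma (M - (a + b - 1))‖⁻¹ * ‖Complex.Gamma (z + (1 - a) + M) *
        Complex.Gamma (a - z) * Complex.exp (l * z)‖ := by
        rw [norm_mul, norm_mul]; ring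
    _ ≤ _ := by rw [mul_assoc _ C]; gcongr

/-- Exponential decay of `Γ(a-z) Γ(b+z) e^{lz}` in the vertical directions. -/
theorem Gamma_mul_Gamma_isBigO_exp_im {a b : ℂ} (hab : 2 ≤ (a + b).re) (l : ℂ) {δ : ℝ}
    (hδ : δ + |l.im| < Real.pi) :
    (fun z => Complex.Gamma (a - z) * Complex.Gamma (b + z) * Complex.exp (l * z))
      =O[verticalInfinity] fun z => Real.exp (-δ * |z.im|) := by
  obtain ⟨C₁, h₁⟩ := Gamma_mul_Gamma_bound_of_one_le_re a b l hδ
  obtain ⟨C₂, h₂⟩ := Gamma_mul_Gamma_bound_of_one_le_re b a (-l) (δ := δ) (by simpa using hδ)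
  refine Asymptotics.IsBigO.of_bound (max C₁ C₂) ?_
  filter_upwards [h₁, tendsto_neg_verticalInfinity.eventually h₂] with z hz₁ hz₂
  rw [Real.norm_eq_abs, Real.abs_exp]
  -- Since Re(a+b) ≥ 2, at least one of b + z and a - z has real part ≥ 1; z ↦ -z exchanges the two
  -- cases.
  rcases le_total 1 (b + z).re with h | h
  · exact (hz₁ h).trans (by gcongr; exact le_max_left _ _)
  · have h' : 1 ≤ (a + -z).re := by
      simp only [Complex.add_re, Complex.neg_re] at hab h ⊢
      linarith
    have := hz₂ h'
    rw [sub_neg_eq_add, ← sub_eq_add_neg, neg_mul_neg, Complex.neg_im, abs_neg,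
      mul_comm (Complex.Gamma _)] at this
    exact this.trans (by gcongr; exact le_max_right _ _)

theorem tendsto_polynomial_mul_Gamma_mul_Gamma {a b : ℂ} (hab : 2 ≤ (a + b).re) {l : ℂ}
    (hl : |l.im| < Real.pi) (P : Polynomial ℂ) :
    Tendsto (fun z => P.eval z * (Complex.Gamma (a - z) * Complex.Gamma (b + z) *
      Complex.exp (l * z))) verticalInfinity (𝓝 0) := by
  set δ := (Real.pi - |l.im|) / 2 with hδ
  have hδ0 : 0 < δ := by rw [hδ]; linarith
  have h := (polynomial_eval_isBigO_exp_im P (half_pos hδ0)).mul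
    (Gamma_mul_Gamma_isBigO_exp_im hab l (δ := δ) (by rw [hδ]; linarith))
  refine h.trans_tendsto ?_
  have h1 : Tendsto (fun z : ℂ => -(δ / 2) * |z.im|) verticalInfinity atBot :=
    tendsto_abs_im_verticalInfinity.const_mul_atTop_of_neg (by linarith)
  refine (Real.tendsto_exp_atBot.comp h1).congr fun z => ?_
  rw [Function.comp_apply, ← Real.exp_add]
  congr 1
  ring

/-! ### The poles of the weight and the conclusion. -/

lemma ascPochhammer_eval_eq_prod (n : ℕ) (w : ℂ) :
    (ascPochhammer ℂ n).eval w = ∏ k ∈ Finset.range n, (w + k) := by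
  induction n with
  | zero => simp
  | succ n ih => rw [ascPochhammer_succ_eval, Finset.prod_range_succ, ih]

lemma IsVerticalContour.exists_abs_re_le {γ : ℝ → ℂ} (hγ : IsVerticalContour γ) (R : ℝ) :
    ∃ B : ℝ, ∀ t, |(γ t).im| ≤ R → |(γ t).re| ≤ B := by
  obtain ⟨b, hb⟩ := eventually_atTop.1 (hγ.im_atTop.eventually_gt_atTop R)
  obtain ⟨a, ha⟩ := eventually_atBot.1 (hγ.im_atBot.eventually_lt_atBot (-R))
  obtain ⟨B, hB⟩ := (isCompact_Icc (a := a) (b := b)).exists_bound_of_continuousOn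
    hγ.continuous.continuousOn
  refine ⟨B, fun t ht => (Complex.abs_re_le_norm _).trans (hB t ⟨?_, ?_⟩)⟩
  · by_contra! h
    linarith [ha t h.le, (abs_le.1 ht).1]
  · by_contra! h
    linarith [hb t h.le, (abs_le.1 ht).2]

/-- The complement of the poles of Γ is the nonvanishing set of the entire function 1/Γ. -/
lemma isOpen_setOf_forall_ne_neg_nat : IsOpen {w : ℂ | ∀ k : ℕ, w ≠ -k} := by
  have h : {w : ℂ | ∀ k : ℕ, w ≠ -k} = {w | (Complex.Gamma w)⁻¹ ≠ 0} := by
    ext w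
    simp [Complex.Gamma_eq_zero_iff]
  rw [h]
  exact isOpen_ne_fun Complex.differentiable_one_div_Gamma.continuous continuous_const

/-- The poles of `Γ(1-z) Γ(β+z)`, indexed by two copies of `ℕ`. -/
def gammaPole (β : ℂ) : ℕ ⊕ ℕ → ℂ := Sum.elim (fun k => (k : ℂ) + 1) (fun k => -β - k)

lemma gammaPole_injective {β : ℂ} (hβ : ∀ k : ℕ, -β ≠ (k : ℂ)) :
    Function.Injective (gammaPole β) := by
  rintro (i | i) (j | j) h
  · simpa [gammaPole] using h
  · refine absurd ?_ (hβ (i + 1 + j))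
    simp only [gammaPole, Sum.elim_inl, Sum.elim_inr] at h
    push_cast
    linear_combination -h
  · refine absurd ?_ (hβ (j + 1 + i))
    simp only [gammaPole, Sum.elim_inl, Sum.elim_inr] at h
    push_cast
    linear_combination h
  · simpa [gammaPole] using h

/-- Raising both Gamma arguments by N removes the N first poles of each family; dividing by the
linear factors restores them up to sign. -/
lemma Gamma_mul_Gamma_div_prod_gammaPole {β x : ℂ} (h1 : ∀ k : ℕ, 1 - x ≠ -k)
    (h2 : ∀ k : ℕ, β + x ≠ -k) (N : ℕ) :
    Complex.Gamma ((N + 1 : ℂ) - x) * Complex.Gamma (β + N + x) /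
      ∏ i ∈ (Finset.range N).disjSum (Finset.range N), (x - gammaPole β i) =
      (-1) ^ N * (Complex.Gamma (1 - x) * Complex.Gamma (β + x)) := by
  have e1 : (ascPochhammer ℂ N).eval (1 - x) =
      (-1) ^ N * ∏ k ∈ Finset.range N, (x - (k + 1)) := by
    rw [ascPochhammer_eval_eq_prod, ← Finset.card_range N, ← Finset.prod_const,
      Finset.card_range, ← Finset.prod_mul_distrib]
    exact Finset.prod_congr rfl fun k _ => by ring
  have e2 : (ascPochhammer ℂ N).eval (β + x) = ∏ k ∈ Finset.range N, (x - (-β - k)) := by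
    rw [ascPochhammer_eval_eq_prod]
    exact Finset.prod_congr rfl fun k _ => by ring
  have n1 : ∏ k ∈ Finset.range N, (x - ((k : ℂ) + 1)) ≠ 0 :=
    Finset.prod_ne_zero_iff.2 fun k _ h => h1 k (by linear_combination -h)
  have n2 : ∏ k ∈ Finset.range N, (x - (-β - k)) ≠ 0 :=
    Finset.prod_ne_zero_iff.2 fun k _ h => h2 k (by linear_combination h)
  rw [show (N + 1 : ℂ) - x = 1 - x + N by ring, show β + N + x = β + x + N by ring,
    Gamma_add_natCast h1, Gamma_add_natCast h2, e1, e2, Finset.prod_disjSum]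
  simp only [gammaPole, Sum.elim_inl, Sum.elim_inr]
  field_simp

theorem mainTheorem4 (β c : ℂ)
    (hc : ∀ r : ℝ, 0 ≤ r → c ≠ (r : ℂ))
    (hβ : ∀ k : ℕ, -β ≠ (k : ℂ))
    (γ : ℝ → ℂ) (hγ : IsVerticalContour γ)
    (hsep : Separates (Set.range γ)
      (Set.range fun k : ℕ => (k : ℂ)) (Set.range fun k : ℕ => -β - (k : ℂ)))
    (n m : ℕ) (hmn : m < n) :
    HasContourIntegral (fun z => meixner n β c z * z ^ m * meixnerWeight β c z) γ 0 := by
  have hc0 : c ≠ 0 := by simpa using hc 0 le_rfl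
  have hc1 : c ≠ 1 := by simpa using hc 1 zero_le_one
  obtain ⟨P, hP⟩ := meixner_mul_pow_mem hc0 hc1 hβ hmn
  obtain ⟨p, q, hp, hq, -⟩ := hsep
  have hA : ∀ k : ℕ, (k : ℂ) ∈ connectedComponentIn (Set.range γ)ᶜ p := fun k => hp ⟨k, rfl⟩
  have hB : ∀ k : ℕ, -β - (k : ℂ) ∈ connectedComponentIn (Set.range γ)ᶜ q := fun k => hq ⟨k, rfl⟩
  have hAγ : ∀ t, ∀ k : ℕ, γ t ≠ k := fun t k h =>
    connectedComponentIn_subset _ _ (hA k) ⟨t, h⟩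
  have hBγ : ∀ t, ∀ k : ℕ, γ t ≠ -β - k := fun t k h =>
    connectedComponentIn_subset _ _ (hB k) ⟨t, h⟩
  set l := Complex.log (-c) with hl
  -- Here c ∉ [0,∞) enters: -c avoids the cut of the logarithm, so its argument is not π.
  have hlπ : |l.im| < Real.pi := by
    rw [hl, Complex.log_im, abs_lt]
    refine ⟨Complex.neg_pi_lt_arg _, lt_of_le_of_ne (Complex.arg_le_pi _) fun h => ?_⟩
    rw [Complex.arg_eq_pi_iff] at h
    simp only [Complex.neg_re, Complex.neg_im, neg_eq_zero] at h
    exact hc c.re (by linarith [h.1]) (Complex.ext (by simp) (by simp [h.2]))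
  -- All poles have |Im| ≤ ‖β‖, and at such heights the contour has bounded real part. The next
  -- choice of N puts the remaining poles N+1+k and -β-N-k outside the swept region and gives Re(N+1
  -- + β+N) ≥ 2.
  obtain ⟨B, hBd⟩ := hγ.exists_abs_re_le ‖β‖
  obtain ⟨N, hN⟩ := exists_nat_gt (|B| + 2 + 2 * ‖β‖)
  have hBB := le_abs_self B
  have hB0 := abs_nonneg B
  have hβ0 := norm_nonneg β
  have hβre := abs_le.1 (Complex.abs_re_le_norm β)
  have hβim := Complex.abs_im_le_norm β
  let Ω : Set ℂ := {z | (∀ k : ℕ, (N + 1 : ℂ) - z ≠ -k) ∧ ∀ k : ℕ, β + N + z ≠ -k}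
  have hΩ : IsOpen Ω :=
    (isOpen_setOf_forall_ne_neg_nat.preimage
      (by fun_prop : Continuous fun z => (N + 1 : ℂ) - z)).inter
    (isOpen_setOf_forall_ne_neg_nat.preimage (by fun_prop : Continuous fun z => β + N + z))
  let E : ℂ → ℂ := fun z => P.eval z * (Complex.Gamma ((N + 1 : ℂ) - z) *
    Complex.Gamma (β + N + z) * Complex.exp (l * z))
  have hE : DifferentiableOn ℂ E Ω := by
    intro z hz
    have h1 : DifferentiableAt ℂ (fun z => Complex.Gamma ((N + 1 : ℂ) - z)) z :=
      (Complex.differentiableAt_Gamma _ hz.1).comp z (by fun_prop)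
    have h2 : DifferentiableAt ℂ (fun z => Complex.Gamma (β + N + z)) z :=
      (Complex.differentiableAt_Gamma _ hz.2).comp z (by fun_prop)
    exact (P.differentiableAt.mul ((h1.mul h2).mul (by fun_prop))).differentiableWithinAt
  have hmem : ∀ t, ∀ s ∈ Set.Icc (0 : ℝ) 1, γ t + s ∈ Ω := by
    rintro t s ⟨hs0, hs1⟩
    constructor
    · intro k h
      have hre := congrArg Complex.re h
      have him := congrArg Complex.im h
      simp at hre him
      have h1 := hBd t (by rw [him]; simp)
      have hk : (0 : ℝ) ≤ k := k.cast_nonneg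
      linarith [(abs_le.1 h1).2]
    · intro k h
      have hre := congrArg Complex.re h
      have him := congrArg Complex.im h
      simp at hre him
      have h1 := hBd t (by rw [show (γ t).im = -β.im by linarith, abs_neg]; exact hβim)
      have hk : (0 : ℝ) ≤ k := k.cast_nonneg
      linarith [(abs_le.1 h1).1]
  have hlim : Tendsto E verticalInfinity (𝓝 0) := by
    refine tendsto_polynomial_mul_Gamma_mul_Gamma ?_ hlπ P
    simp
    linarith
  have hN0 : 0 < N := by
    rw [← Nat.cast_pos (α := ℝ)]
    linarith
  have hpole : ∀ i ∈ (Finset.range N).disjSum (Finset.range N), gammaPole β i ∈ Ω := by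
    rintro (i | i) hi
    · have hi' : i < N := by simpa using hi
      refine ⟨fun k h => ?_, fun k h => hβ (N + i + 1 + k) ?_⟩
      · have h' : ((N + k : ℕ) : ℂ) = (i : ℕ) := by
          simp only [gammaPole, Sum.elim_inl] at h
          push_cast
          linear_combination h
        have := Nat.cast_injective h'
        lia
      · simp only [gammaPole, Sum.elim_inl] at h
        push_cast
        linear_combination -h
    · have hi' : i < N := by simpa using hi
      refine ⟨fun k h => hβ (N + 1 + i + k) ?_, fun k h => ?_⟩
      · simp only [gammaPole, Sum.elim_inr] at h
        push_cast
        linear_combination -h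
      · have h' : ((N + k : ℕ) : ℂ) = (i : ℕ) := by
          simp only [gammaPole, Sum.elim_inr] at h
          push_cast
          linear_combination h
        have := Nat.cast_injective h'
        lia
  -- Separation enters here: p ↦ p - 1 sends k + 1 to k and -β - k to -β - (k+1), within the same
  -- component. The right-hand poles of G start at 1, so p - 1 is still one of 0, 1, 2, ….
  have key := HasContourIntegral.translate_sub_of_simple_poles hγ hγ.isClosed_range hΩ hE hlim hmem
    (S := (Finset.range N).disjSum (Finset.range N)) ⟨Sum.inl 0, by simpa using hN0⟩
    (v := gammaPole β) (gammaPole_injective hβ).injOn hpole (by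
      rintro (i | i) -
      · exact ⟨_, isPreconnected_connectedComponentIn, connectedComponentIn_subset _ _,
          by simpa [gammaPole] using hA (i + 1), by simpa [gammaPole] using hA i⟩
      · refine ⟨_, isPreconnected_connectedComponentIn, connectedComponentIn_subset _ _,
          hB i, ?_⟩
        convert hB (i + 1) using 1
        simp only [gammaPole, Sum.elim_inr]
        push_cast
        ring)
  have key' := key.const_mul ((-1) ^ N)
  rw [mul_zero] at key'
  refine key'.congr fun t => ?_
  set z := γ t with hz
  have hG : ∀ x : ℂ, (∀ k : ℕ, 1 - x ≠ -k) → (∀ k : ℕ, β + x ≠ -k) →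
      E x / ∏ i ∈ (Finset.range N).disjSum (Finset.range N), (x - gammaPole β i) =
        (-1) ^ N * (P.eval x * (Complex.Gamma (1 - x) * Complex.Gamma (β + x)) *
          Complex.exp (l * x)) := by
    intro x h1 h2
    have h := Gamma_mul_Gamma_div_prod_gammaPole h1 h2 N
    simp only [E]
    calc _ = P.eval x * Complex.exp (l * x) * (Complex.Gamma ((N + 1 : ℂ) - x) *
          Complex.Gamma (β + N + x) /
          ∏ i ∈ (Finset.range N).disjSum (Finset.range N), (x - gammaPole β i)) := by ring
      _ = _ := by rw [h]; ring
  have hz1 : ∀ k : ℕ, z ≠ k := hAγ t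
  have hz2 : ∀ k : ℕ, z ≠ -β - k := hBγ t
  have hPz : meixner n β c z * z ^ m =
      z * P.eval z - c * (β + z) * P.eval (z + 1) := hP z
  have hneg : (-1 : ℂ) ^ N * (-1) ^ N = 1 := by rw [← mul_pow]; simp
  rw [hG z (fun k h => hz1 (k + 1) (by push_cast; linear_combination -h))
      (fun k h => hz2 k (by linear_combination h)),
    hG (z + 1) (fun k h => hz1 k (by linear_combination -h))
      (fun k h => hz2 (k + 1) (by push_cast; linear_combination h)), ← mul_sub, ← mul_assoc, hneg,
    one_mul, show (1 : ℂ) - (z + 1) = -z by ring, show (1 : ℂ) - z = -z + 1 by ring,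
    ← add_assoc β z 1, Complex.Gamma_add_one _ (neg_ne_zero.2 (by simpa using hz1 0)),
    Complex.Gamma_add_one _ (fun h => hz2 0 (by push_cast; linear_combination h)),
    mul_add, Complex.exp_add, mul_one, hl, Complex.exp_log (neg_ne_zero.2 hc0), hPz,
    meixnerWeight, Complex.cpow_def_of_ne_zero (neg_ne_zero.2 hc0)]
  ring
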